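/- Let $p$ be a prime and let $d,m\ge 1$ be integers. For a commutative ring $R$ let $G_d(R)$ be the ring (under pointwise operations) of polyfunctions in $d$ variables over $R$, i.e. of the functions $f:R^d\to R$ for which some polynomial $q\in R[x_1,\dots,x_d]$ satisfies $q(x)=f(x)$ for all $x\in R^d$, and let $\Psi_d(n)=|G_d(\mathbb Z/n\mathbb Z)|$. For $k=(k_1,\dots,k_d)\in\mathbb N_0^d$ put $k!=\prod_{i=1}^d k_i!$, let $e_p(k)=\max\{x\in\mathbb N_0: p^x\mid k!\}$, and let $s_d(n)=|S_d(n)|$ where $S_d(n)=\{k\in\mathbb N_0^d: n\nmid k!\}$. Then the set $\{k\in\mathbb N_0^d: e_p(k)<m\}$ and all the sets $S_d(p^j)$, $j\ge 0$, are finite, and $$\Psi_d(p^m)=\prod_{\substack{k\in\mathbb N_0^d\\ e_p(k)<m}}p^{\,m-e_p(k)}=p^{\sum_{j=1}^m s_d(p^j)}.$$ Moreover, let $h:\mathbb Z/p^{m+1}\mathbb Z\to\mathbb Z/p^m\mathbb Z$ be the canonical map and let $h^*:\mathbb Z/p^m\mathbb Z\to\mathbb Z/p^{m+1}\mathbb Z$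 send $[x]_{p^m}$ to $[x]_{p^{m+1}}$ for $0\le x<p^m$. Then $H(f)=h\circ f\circ h^*$ (with $h^*$ applied in each coordinate) defines a surjective ring homomorphism $H:G_d(\mathbb Z/p^{m+1}\mathbb Z)\to G_d(\mathbb Z/p^m\mathbb Z)$, and $|\ker H|=p^{s_d(p^{m+1})}$. -/

import Mathlib

namespace Polyfunction

/-- The ring `G_d(R)` of polyfunctions in `d` variables over `R`: the functions `R^d → R` that
are represented by a polynomial in `R[x_1, …, x_d]`, with pointwise operations. -/
def polyfunctionRing (d : ℕ) (R : Type*) [CommRing R] : Subring ((Fin d → R) → R) where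
  carrier := {f | ∃ q : MvPolynomial (Fin d) R, ∀ x, MvPolynomial.eval x q = f x}
  mul_mem' := by
    rintro f g ⟨q, hq⟩ ⟨r, hr⟩
    exact ⟨q * r, fun x => by simp [hq, hr]⟩
  one_mem' := ⟨1, fun x => by simp⟩
  add_mem' := by
    rintro f g ⟨q, hq⟩ ⟨r, hr⟩
    exact ⟨q + r, fun x => by simp [hq, hr]⟩
  zero_mem' := ⟨0, fun x => by simp⟩
  neg_mem' := by
    rintro f ⟨q, hq⟩
    exact ⟨-q, fun x => by simp [hq]⟩

/-- `Ψ_d(n)`: the number of polyfunctions in `d` variables over `ℤ/nℤ`. -/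
noncomputable def numPolyfunctions (d n : ℕ) : ℕ :=
  Nat.card (polyfunctionRing d (ZMod n))

/-- `k! = ∏ i, k_i!` for a multi-index `k`. -/
def multiFactorial {d : ℕ} (k : Fin d → ℕ) : ℕ := ∏ i, (k i).factorial

/-- `e_p(k)`: the exponent of `p` in `k!`. -/
def expFactorial (p : ℕ) {d : ℕ} (k : Fin d → ℕ) : ℕ := padicValNat p (multiFactorial k)

/-- For `p` prime, `e_p(k) = max {x : p^x ∣ k!}`. -/
theorem isGreatest_expFactorial (p : ℕ) [Fact p.Prime] {d : ℕ} (k : Fin d → ℕ) :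
    IsGreatest {x : ℕ | p ^ x ∣ multiFactorial k} (expFactorial p k) := by
  have h0 : multiFactorial k ≠ 0 := Finset.prod_ne_zero_iff.2 fun i _ => Nat.factorial_ne_zero _
  exact ⟨pow_padicValNat_dvd, fun x hx => (padicValNat_dvd_iff_le h0).1 hx⟩

/-- `S_d(n) = {k ∈ ℕ₀^d : n ∤ k!}`. -/
def smarandacheSet (d n : ℕ) : Set (Fin d → ℕ) := {k | ¬ n ∣ multiFactorial k}

/-- The generalized Smarandache function `s_d(n) = |S_d(n)|`. -/
noncomputable def smarandache (d n : ℕ) : ℕ := (smarandacheSet d n).ncard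

/-- The map `h^* : ℤ/nℤ → ℤ/Nℤ`, `[x]_n ↦ [x]_N` for `0 ≤ x < n`. -/
def liftRep (n N : ℕ) (a : ZMod n) : ZMod N := (a.val : ZMod N)

/-- The reduction map `H : G_d(ℤ/Nℤ) → G_d(ℤ/nℤ)`, `f ↦ h ∘ f ∘ h^*`, for `n ∣ N`, where
`h : ℤ/Nℤ → ℤ/nℤ` is the canonical map and `h^*` is applied in each coordinate. -/
def reduction (d : ℕ) {n N : ℕ} [NeZero n] (hn : n ∣ N) :
    polyfunctionRing d (ZMod N) →+* polyfunctionRing d (ZMod n) where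
  toFun f := ⟨fun x => ZMod.castHom hn (ZMod n) (f.1 fun i => liftRep n N (x i)), by
    obtain ⟨q, hq⟩ := f.2
    refine ⟨MvPolynomial.map (ZMod.castHom hn (ZMod n)) q, fun x => ?_⟩
    change _ = ZMod.castHom hn (ZMod n) (f.1 fun i => liftRep n N (x i))
    rw [← hq, MvPolynomial.eval_map, ← MvPolynomial.eval₂_id, MvPolynomial.eval₂_comp_left]
    congr 1
    funext i
    simp [liftRep]⟩
  map_one' := Subtype.ext <| funext fun _ => map_one (ZMod.castHom hn (ZMod n))
  map_mul' _ _ := Subtype.ext <| funext fun _ => map_mul (ZMod.castHom hn (ZMod n)) _ _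
  map_zero' := Subtype.ext <| funext fun _ => map_zero (ZMod.castHom hn (ZMod n))
  map_add' _ _ := Subtype.ext <| funext fun _ => map_add (ZMod.castHom hn (ZMod n)) _ _

end Polyfunction

namespace Polyfunction

open Finset

/-! The falling factorials $(x)_k$ span the polyfunctions. At natural points $(x)_k=k!\binom{x}{k}$,
and every point of $(\mathbb Z/n)^d$ is of this form, so by triangularity $\sum a_k (x)_k$ vanishes
iff every $k!\,a_k=0$ (`multiFactorial_mul_eq_zero_of_sum_eq_zero`). Hence $G_d(\mathbb
Z/n)\cong\prod_k k!\,\mathbb Z/n$ additively, of order $\prod_k n/\gcd(n,k!)$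
(`numPolyfunctions_eq_prod`). For $n=p^m$, double counting turns the exponent into a sum of
$s_d(p^j)$. Since $H$ is onto, $|\ker H|=\Psi_d(p^{m+1})/\Psi_d(p^m)$. -/

/-- The function `x ↦ ∏ i, x_i (x_i - 1) ⋯ (x_i - k_i + 1)`. -/
noncomputable def fallingFun {d : ℕ} (R : Type*) [CommRing R] (k : Fin d → ℕ) :
    (Fin d → R) → R :=
  fun x => ∏ i, (descPochhammer R (k i)).eval (x i)

/-! ### Falling factorials over a commutative ring -/

section CommRing

variable {d : ℕ} {R : Type*} [CommRing R]

theorem fallingFun_natCast (k n : Fin d → ℕ) :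
    fallingFun R k (fun i => (n i : R)) =
      (multiFactorial k : R) * ∏ i, ((n i).choose (k i) : R) := by
  simp only [fallingFun, descPochhammer_eval_eq_descFactorial,
    Nat.descFactorial_eq_factorial_mul_choose, multiFactorial, Nat.cast_mul, Nat.cast_prod,
    Finset.prod_mul_distrib]

theorem fallingFun_mem_polyfunctionRing (k : Fin d → ℕ) :
    fallingFun R k ∈ polyfunctionRing d R := by
  refine ⟨∏ i, Polynomial.aeval (MvPolynomial.X i) (descPochhammer R (k i)), fun x => ?_⟩
  rw [map_prod]
  refine Finset.prod_congr rfl fun i _ => ?_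
  rw [← MvPolynomial.coe_aeval_eq_eval, RingHom.coe_coe, ← Polynomial.aeval_algHom_apply,
    MvPolynomial.aeval_X, Polynomial.coe_aeval_eq_eval]

theorem fallingFun_zero : fallingFun R (0 : Fin d → ℕ) = 1 := by
  funext x
  simp [fallingFun]

/-- From $(t)_{n+1}=(t)_n(t-n)$ in coordinate $j$; this makes the span stable under multiplication
by coordinates. -/
theorem fallingFun_mul_apply (k : Fin d → ℕ) (j : Fin d) (x : Fin d → R) :
    fallingFun R k x * x j =
      fallingFun R (Function.update k j (k j + 1)) x + (k j : R) * fallingFun R k x := by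
  have h : ∀ n : ℕ, fallingFun R (Function.update k j n) x =
      (descPochhammer R n).eval (x j) *
        ∏ i ∈ univ.erase j, (descPochhammer R (k i)).eval (x i) := by
    intro n
    rw [fallingFun, ← Finset.mul_prod_erase univ _ (mem_univ j), Function.update_self]
    congr 1
    refine Finset.prod_congr rfl fun i hi => ?_
    rw [Function.update_of_ne (Finset.ne_of_mem_erase hi)]
  have h0 := h (k j)
  rw [Function.update_eq_self] at h0
  rw [h, h0, descPochhammer_succ_eval]
  ring

theorem mul_coord_mem_span_fallingFun {f : (Fin d → R) → R}
    (hf : f ∈ Submodule.span R (Set.range (fallingFun R : (Fin d → ℕ) → _))) (j : Fin d) :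
    (fun x => f x * x j) ∈
      Submodule.span R (Set.range (fallingFun R : (Fin d → ℕ) → _)) := by
  induction hf using Submodule.span_induction with
  | mem f hf =>
    obtain ⟨k, rfl⟩ := hf
    have : (fun x => fallingFun R k x * x j) =
        fallingFun R (Function.update k j (k j + 1)) + (k j : R) • fallingFun R k :=
      funext (fallingFun_mul_apply k j)
    rw [this]
    exact Submodule.add_mem _ (Submodule.subset_span ⟨_, rfl⟩)
      (Submodule.smul_mem _ _ (Submodule.subset_span ⟨k, rfl⟩))
  | zero =>
    simp only [Pi.zero_apply, zero_mul]
    exact Submodule.zero_mem _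
  | add f g _ _ hf hg =>
    simp only [Pi.add_apply, add_mul]
    exact Submodule.add_mem _ hf hg
  | smul a f _ hf =>
    simp only [Pi.smul_apply, smul_mul_assoc]
    exact Submodule.smul_mem _ a hf

theorem mem_span_fallingFun_of_eval (q : MvPolynomial (Fin d) R) :
    (fun x => MvPolynomial.eval x q) ∈
      Submodule.span R (Set.range (fallingFun R : (Fin d → ℕ) → _)) := by
  induction q using MvPolynomial.induction_on with
  | C a =>
    have : (fun x => MvPolynomial.eval x (MvPolynomial.C a)) =
        a • fallingFun R (0 : Fin d → ℕ) := by
      funext x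
      simp [fallingFun_zero]
    rw [this]
    exact Submodule.smul_mem _ _ (Submodule.subset_span ⟨0, rfl⟩)
  | add p q hp hq =>
    simp only [map_add]
    exact Submodule.add_mem _ hp hq
  | mul_X p j hp =>
    simp only [map_mul, MvPolynomial.eval_X]
    exact mul_coord_mem_span_fallingFun hp j

theorem mem_polyfunctionRing_iff_mem_span {f : (Fin d → R) → R} :
    f ∈ polyfunctionRing d R ↔
      f ∈ Submodule.span R (Set.range (fallingFun R : (Fin d → ℕ) → _)) := by
  constructor
  · rintro ⟨q, hq⟩
    rw [← funext hq]
    exact mem_span_fallingFun_of_eval q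
  · intro hf
    induction hf using Submodule.span_induction with
    | mem f hf =>
      obtain ⟨k, rfl⟩ := hf
      exact fallingFun_mem_polyfunctionRing k
    | zero => exact Subring.zero_mem _
    | add f g _ _ hf hg => exact Subring.add_mem _ hf hg
    | smul a f _ hf =>
      obtain ⟨q, hq⟩ := hf
      exact ⟨MvPolynomial.C a * q, fun x => by simp [hq]⟩

/-- A combination of falling factorials vanishes on `ℕ^d` only if its coefficients are
annihilated by the corresponding factorials. -/
theorem multiFactorial_mul_eq_zero_of_sum_eq_zero (s : Finset (Fin d → ℕ))
    (a : (Fin d → ℕ) → R) (h : ∀ x, ∑ k ∈ s, a k * fallingFun R k x = 0) (k : Fin d → ℕ)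
    (hk : k ∈ s) : (multiFactorial k : R) * a k = 0 := by
  -- Evaluate at $x=k$: terms $l<k$ vanish by induction, terms $l\not\le k$ contain a zero binomial,
  -- and $l=k$ leaves $k!\,a_k$.
  induction k using WellFoundedLT.induction with
  | ind k ih =>
    have hx := h fun i => (k i : R)
    rw [Finset.sum_eq_single_of_mem k hk] at hx
    · simpa [fallingFun_natCast, mul_comm] using hx
    · intro l hl hlk
      rw [fallingFun_natCast]
      by_cases hle : l ≤ k
      · rw [← mul_assoc, mul_comm (a l), ih l (lt_of_le_of_ne hle hlk) hl, zero_mul]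
      · obtain ⟨i, hi⟩ := not_forall.1 hle
        rw [Finset.prod_eq_zero (mem_univ i), mul_zero, mul_zero]
        rw [Nat.choose_eq_zero_of_lt (not_le.1 hi), Nat.cast_zero]

end CommRing

/-! ### Counting polyfunctions modulo n -/

theorem fallingFun_eq_zero {d n : ℕ} [NeZero n] {k : Fin d → ℕ} (hk : n ∣ multiFactorial k) :
    fallingFun (ZMod n) k = 0 := by
  funext x
  have hx : x = fun i => ((x i).val : ZMod n) := by simp
  rw [hx, fallingFun_natCast, (ZMod.natCast_eq_zero_iff _ _).2 hk, zero_mul, Pi.zero_apply]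

theorem fallingFun_eq_multiFactorial_mul {d n : ℕ} [NeZero n] (k : Fin d → ℕ)
    (x : Fin d → ZMod n) : fallingFun (ZMod n) k x =
      (multiFactorial k : ZMod n) * ∏ i, ((x i).val.choose (k i) : ZMod n) := by
  rw [← fallingFun_natCast]
  simp

theorem card_range_natCast_mul (n c : ℕ) [NeZero n] :
    Nat.card (Set.range fun a : ZMod n => (c : ZMod n) * a) = n / n.gcd c := by
  have : (Set.range fun a : ZMod n => (c : ZMod n) * a) =
      (AddSubgroup.zmultiples (c : ZMod n) : Set (ZMod n)) := by
    ext y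
    simp only [Set.mem_range, SetLike.mem_coe, AddSubgroup.mem_zmultiples_iff, zsmul_eq_mul]
    constructor
    · rintro ⟨a, rfl⟩
      exact ⟨a.val, by simp [mul_comm]⟩
    · rintro ⟨z, rfl⟩
      exact ⟨z, mul_comm _ _⟩
  rw [this]
  exact (Nat.card_zmultiples _).trans (ZMod.addOrderOf_coe c (NeZero.ne n))

/-- Two linear maps with the same kernel have ranges of the same size. -/
theorem card_range_eq_of_ker_eq {R M N P : Type*} [Ring R] [AddCommGroup M] [AddCommGroup N]
    [AddCommGroup P] [Module R M] [Module R N] [Module R P] (f : M →ₗ[R] N) (g : M →ₗ[R] P)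
    (h : LinearMap.ker f = LinearMap.ker g) :
    Nat.card (LinearMap.range f) = Nat.card (LinearMap.range g) :=
  Nat.card_congr (f.quotKerEquivRange.symm.trans
    ((Submodule.quotEquivOfEq _ _ h).trans g.quotKerEquivRange)).toEquiv

theorem numPolyfunctions_eq_prod {d n : ℕ} [NeZero n] (s : Finset (Fin d → ℕ))
    (hs : ∀ k, k ∉ s → n ∣ multiFactorial k) :
    numPolyfunctions d n = ∏ k ∈ s, n / n.gcd (multiFactorial k) := by
  let F : (s → ZMod n) →ₗ[ZMod n] ((Fin d → ZMod n) → ZMod n) :=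
    Fintype.linearCombination (ZMod n) fun k : s => fallingFun (ZMod n) k.1
  -- A diagonal map with the same kernel as `F`, whose range is a product of cyclic groups and so
  -- easy to count.
  let g : (s → ZMod n) →ₗ[ZMod n] (s → ZMod n) :=
    LinearMap.mulLeft (ZMod n) fun k : s => (multiFactorial k.1 : ZMod n)
  have hF : ∀ a x, F a x = ∑ k : s, a k * fallingFun (ZMod n) k.1 x := fun a x => by
    simp [F, Fintype.linearCombination_apply]
  have hrange : ∀ f, f ∈ polyfunctionRing d (ZMod n) ↔ f ∈ LinearMap.range F := by
    intro f
    rw [mem_polyfunctionRing_iff_mem_span, Fintype.range_linearCombination]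
    refine ⟨fun h => Submodule.span_le.2 ?_ h, fun h => Submodule.span_mono ?_ h⟩
    · rintro _ ⟨k, rfl⟩
      by_cases hk : k ∈ s
      · exact Submodule.subset_span ⟨⟨k, hk⟩, rfl⟩
      · rw [fallingFun_eq_zero (hs k hk)]
        exact Submodule.zero_mem _
    · rintro _ ⟨k, rfl⟩
      exact ⟨k.1, rfl⟩
  have hker : LinearMap.ker F = LinearMap.ker g := by
    ext a
    simp only [LinearMap.mem_ker]
    constructor
    · intro ha
      funext k
      have := multiFactorial_mul_eq_zero_of_sum_eq_zero s
        (fun k => if hk : k ∈ s then a ⟨k, hk⟩ else 0) (fun x => by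
          rw [← Finset.sum_coe_sort]
          simpa [hF] using congrFun ha x) k.1 k.2
      simpa [g] using this
    · intro ha
      funext x
      rw [hF, Pi.zero_apply]
      refine Finset.sum_eq_zero fun k _ => ?_
      have hk : (multiFactorial k.1 : ZMod n) * a k = 0 := congrFun ha k
      rw [fallingFun_eq_multiFactorial_mul, ← mul_assoc, mul_comm (a k), hk, zero_mul]
  have hg : (LinearMap.range g : Set (s → ZMod n)) =
      Set.univ.pi fun k : s => Set.range fun a : ZMod n => (multiFactorial k.1 : ZMod n) * a := by
    rw [← Set.range_piMap]
    rfl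
  calc numPolyfunctions d n = Nat.card (LinearMap.range F) :=
        Nat.card_congr (Equiv.subtypeEquivRight hrange)
    _ = Nat.card (LinearMap.range g) := card_range_eq_of_ker_eq F g hker
    _ = Nat.card (Set.univ.pi fun k : s =>
          Set.range fun a : ZMod n => (multiFactorial k.1 : ZMod n) * a) :=
        Nat.card_congr (Equiv.setCongr hg)
    _ = ∏ k : s, n / n.gcd (multiFactorial k.1) := by
        rw [Nat.card_congr (Equiv.Set.univPi _), Nat.card_pi]
        exact Finset.prod_congr rfl fun k _ => card_range_natCast_mul _ _
    _ = _ := Finset.prod_coe_sort s fun k => n / n.gcd (multiFactorial k)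

theorem multiFactorial_ne_zero {d : ℕ} (k : Fin d → ℕ) : multiFactorial k ≠ 0 :=
  Finset.prod_ne_zero_iff.2 fun _ _ => Nat.factorial_ne_zero _

/-! ### Prime powers -/

section Prime

variable {d p : ℕ} [Fact p.Prime]

theorem pow_dvd_multiFactorial_iff {j : ℕ} {k : Fin d → ℕ} :
    p ^ j ∣ multiFactorial k ↔ j ≤ expFactorial p k :=
  padicValNat_dvd_iff_le (multiFactorial_ne_zero k)

theorem smarandacheSet_pow (j : ℕ) :
    smarandacheSet d (p ^ j) = {k | expFactorial p k < j} := by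
  ext k
  simp [smarandacheSet, pow_dvd_multiFactorial_iff]

theorem finite_smarandacheSet (d : ℕ) {n : ℕ} (hn : n ≠ 0) : (smarandacheSet d n).Finite := by
  -- A coordinate $k_i>n$ forces $n\mid k_i!$, so the set lies in a box.
  refine (Set.finite_Iic (fun _ : Fin d => n)).subset fun k hk i => ?_
  by_contra hi
  exact hk ((Nat.dvd_factorial (Nat.pos_of_ne_zero hn) (not_le.1 hi).le).trans
    (Finset.dvd_prod_of_mem _ (mem_univ i)))

theorem finite_expFactorial_lt (d p m : ℕ) [Fact p.Prime] :
    {k : Fin d → ℕ | expFactorial p k < m}.Finite := by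
  rw [← smarandacheSet_pow]
  exact finite_smarandacheSet d (pow_ne_zero _ (Fact.out : p.Prime).ne_zero)

theorem pow_div_gcd_multiFactorial {m : ℕ} {k : Fin d → ℕ} (hk : expFactorial p k < m) :
    p ^ m / (p ^ m).gcd (multiFactorial k) = p ^ (m - expFactorial p k) := by
  have hp : p.Prime := Fact.out
  have hgcd : (p ^ m).gcd (multiFactorial k) = p ^ expFactorial p k := by
    obtain ⟨e, -, he⟩ := (Nat.dvd_prime_pow hp).1 (Nat.gcd_dvd_left (p ^ m) (multiFactorial k))
    refine Nat.dvd_antisymm ?_ (Nat.dvd_gcd (pow_dvd_pow p hk.le)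
      (pow_dvd_multiFactorial_iff.2 le_rfl))
    rw [he]
    exact pow_dvd_pow p (pow_dvd_multiFactorial_iff.1 (he ▸ Nat.gcd_dvd_right _ _))
  rw [hgcd, Nat.pow_div hk.le hp.pos]

theorem numPolyfunctions_pow (m : ℕ) : numPolyfunctions d (p ^ m) =
    ∏ k ∈ (finite_expFactorial_lt d p m).toFinset, p ^ (m - expFactorial p k) := by
  have : NeZero (p ^ m) := ⟨pow_ne_zero _ (Fact.out : p.Prime).ne_zero⟩
  rw [numPolyfunctions_eq_prod (finite_expFactorial_lt d p m).toFinset]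
  · exact Finset.prod_congr rfl fun k hk => pow_div_gcd_multiFactorial (by simpa using hk)
  · intro k hk
    exact pow_dvd_multiFactorial_iff.2 (by simpa using hk)

theorem sum_sub_expFactorial (m : ℕ) :
    ∑ k ∈ (finite_expFactorial_lt d p m).toFinset, (m - expFactorial p k) =
      ∑ j ∈ Icc 1 m, smarandache d (p ^ j) := by
  -- Count the pairs $(k,j)$ with $e_p(k)<j\le m$ in two ways.
  have h := Finset.sum_card_bipartiteAbove_eq_sum_card_bipartiteBelow
    (s := (finite_expFactorial_lt d p m).toFinset) (t := Icc 1 m)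
    fun k j => expFactorial p k < j
  refine Eq.trans (Finset.sum_congr rfl fun k _ => ?_)
    (h.trans (Finset.sum_congr rfl fun j hj => ?_))
  · have : (Icc 1 m).bipartiteAbove (fun k j => expFactorial p k < j) k =
        Ioc (expFactorial p k) m := by
      ext j
      simp only [mem_bipartiteAbove, mem_Icc, mem_Ioc]
      omega
    rw [this, Nat.card_Ioc]
  · rw [smarandache, smarandacheSet_pow, ← Set.ncard_coe_finset]
    congr 1
    ext k
    have := (mem_Icc.1 hj).2
    simp only [coe_bipartiteBelow, Set.Finite.mem_toFinset, Set.mem_ofPred_eq]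
    omega

end Prime

/-! ### The reduction map -/

/-- As $h\circ h^*=\mathrm{id}$, $H$ just reduces the coefficients of any representing polynomial;
surjectivity follows by lifting coefficients. -/
theorem reduction_apply_of_eval {d n N : ℕ} [NeZero n] (hn : n ∣ N)
    (f : polyfunctionRing d (ZMod N)) (q : MvPolynomial (Fin d) (ZMod N))
    (hq : ∀ x, MvPolynomial.eval x q = f.1 x) (x : Fin d → ZMod n) :
    (reduction d hn f).1 x =
      MvPolynomial.eval x (MvPolynomial.map (ZMod.castHom hn (ZMod n)) q) := by
  change ZMod.castHom hn (ZMod n) (f.1 fun i => liftRep n N (x i)) = _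
  rw [← hq, MvPolynomial.eval_map, ← MvPolynomial.eval₂_id, MvPolynomial.eval₂_comp_left]
  congr 1
  funext i
  simp [liftRep]

theorem reduction_surjective (d : ℕ) {n N : ℕ} [NeZero n] (hn : n ∣ N) :
    Function.Surjective (reduction d hn) := by
  rintro ⟨f, r, hr⟩
  obtain ⟨q, rfl⟩ := MvPolynomial.map_surjective _ (ZMod.castHom_surjective hn) r
  refine ⟨⟨fun x => MvPolynomial.eval x q, q, fun _ => rfl⟩, Subtype.ext <| funext fun x => ?_⟩
  rw [reduction_apply_of_eval hn _ q fun _ => rfl]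
  exact hr x

theorem numPolyfunctions_eq_mul_card_ker (d : ℕ) {n N : ℕ} [NeZero n] (hn : n ∣ N) :
    numPolyfunctions d N =
      numPolyfunctions d n * Nat.card (RingHom.ker (reduction d hn)) := by
  have h := AddSubgroup.card_eq_card_quotient_mul_card_addSubgroup
    (reduction d hn).toAddMonoidHom.ker
  rw [Nat.card_congr (QuotientAddGroup.quotientKerEquivOfSurjective _
    (reduction_surjective d hn)).toEquiv] at h
  exact h

end Polyfunction

theorem proposition4 (d p m : ℕ) [Fact p.Prime] :
    (∃ hfin : {k : Fin d → ℕ | Polyfunction.expFactorial p k < m}.Finite,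
      Polyfunction.numPolyfunctions d (p ^ m) =
        ∏ k ∈ hfin.toFinset, p ^ (m - Polyfunction.expFactorial p k) ∧
      ∏ k ∈ hfin.toFinset, p ^ (m - Polyfunction.expFactorial p k) =
        p ^ ∑ j ∈ Finset.Icc 1 m, Polyfunction.smarandache d (p ^ j)) ∧
    Polyfunction.numPolyfunctions d (p ^ m) =
      p ^ ∑ j ∈ Finset.Icc 1 m, Polyfunction.smarandache d (p ^ j) ∧
    (∀ j : ℕ, (Polyfunction.smarandacheSet d (p ^ j)).Finite) ∧
    Function.Surjective
      (Polyfunction.reduction d (pow_dvd_pow p (Nat.le_succ m) : p ^ m ∣ p ^ (m + 1))) ∧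
    Nat.card (RingHom.ker
      (Polyfunction.reduction d (pow_dvd_pow p (Nat.le_succ m) : p ^ m ∣ p ^ (m + 1)))) =
        p ^ Polyfunction.smarandache d (p ^ (m + 1)) := by
  have hp : p.Prime := Fact.out
  have hprod : ∀ m, ∏ k ∈ (Polyfunction.finite_expFactorial_lt d p m).toFinset,
      p ^ (m - Polyfunction.expFactorial p k) =
        p ^ ∑ j ∈ Finset.Icc 1 m, Polyfunction.smarandache d (p ^ j) := fun m => by
    rw [Finset.prod_pow_eq_pow_sum, Polyfunction.sum_sub_expFactorial]
  have hnum := fun m => (Polyfunction.numPolyfunctions_pow (d := d) (p := p) m).trans (hprod m)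
  refine ⟨⟨Polyfunction.finite_expFactorial_lt d p m, Polyfunction.numPolyfunctions_pow m,
    hprod m⟩, hnum m, fun j => Polyfunction.finite_smarandacheSet d (pow_ne_zero j hp.ne_zero),
    Polyfunction.reduction_surjective d _, ?_⟩
  have h := Polyfunction.numPolyfunctions_eq_mul_card_ker d
    (pow_dvd_pow p (Nat.le_succ m) : p ^ m ∣ p ^ (m + 1))
  -- Splitting off the term $j=m+1$ exposes the common factor $\Psi_d(p^m)$ to cancel.
  rw [hnum, hnum, Finset.sum_Icc_succ_top (Nat.le_add_left 1 m), pow_add] at h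
  exact (Nat.eq_of_mul_eq_mul_left (pow_pos hp.pos _) h).symm
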